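/- Let $\mathcal A:\mathbb R^{m\times n}\to\mathbb R^{l}$ be a linear map, let $X^o\in\mathbb R^{m\times n}$, and let $b=\mathcal A(X^o)+s$ with $\|s\|_2\le\epsilon$. Let $\lambda>0$ and $$J(X)=\|X\|_*-\|X\|_F+\frac1{2\lambda}\|\mathcal A(X)-b\|_2^2 ,\qquad X\in\mathbb R^{m\times n},$$ where $\|\cdot\|_*$ is the nuclear norm (the sum of the singular values) and $\|\cdot\|_F$ is the Frobenius norm. For $r\in\mathbb N$ let $\delta_r$ be the isometry constant of $\mathcal A$, i.e. the smallest number such that $(1-\delta_r)\|X\|_F^2\le\|\mathcal A(X)\|_2^2\le(1+\delta_r)\|X\|_F^2$ for all $X\in\mathbb R^{m\times n}$ of rank at most $r$. **Theorem.** Let $k\ge 6$ and $t>1$ be integers, put $\theta_k=\dfrac{\sqrt k+\sqrt2-1}{\sqrt k-\sqrt2-1}$, and suppose that $$\delta_{tk}<\sqrt{\frac{t-1}{t+\theta_k^2-1}} .$$ Write $\delta=\delta_{tk}$ and $$\beta_1=\frac{\delta}{\sqrt{(t-1)(1-\delta^2)}},\quad \gamma_1=\frac{2}{(1-\delta)\sqrt{1+\delta}},\quad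 \eta=\frac{\epsilon}{\lambda},\quad \hat\beta_1=(\sqrt2-1)\beta_1+1,\quad \hat\gamma_1=\sqrt k\,\gamma_1+\eta,$$ $$\xi_1=\sqrt{2k}\,\gamma_1+\hat\beta_1\eta,\qquad \kappa_1=1-\frac{\hat\beta_1\hat\gamma_1+\xi_1}{\sqrt k(1-\beta_1)\hat\gamma_1}.$$ Then $\delta<1$, $\beta_1<1$, $\hat\gamma_1>0$ and $\kappa_1>0$, and every global minimizer $X^*$ of $J$ satisfies $$\|X^*-X^o\|_F\le C_1\|X^o\|_*+C_2\lambda,\qquad C_1=\frac{2(\hat\beta_1\hat\gamma_1+\xi_1)}{\sqrt k(1-\beta_1)\hat\gamma_1\kappa_1},\quad C_2=\frac{2\xi_1\hat\gamma_1}{\sqrt k(1-\beta_1)\kappa_1}.$$ -/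

import Mathlib

open scoped Matrix.Norms.Frobenius

noncomputable section

namespace LowRankRecovery

/-- The nuclear norm of a real `m × n` matrix: the sum of its `min m n` singular values
`σ₁ ≥ … ≥ σ_{min m n} ≥ 0` (the library's sequence of singular values starts at index `0`). -/
def nuclearNorm {m n : ℕ} (X : Matrix (Fin m) (Fin n) ℝ) : ℝ :=
  ∑ i ∈ Finset.range (min m n), (Matrix.toEuclideanLin X).singularValues i

/-- The constants `δ` such that `(1 - δ)‖X‖_F² ≤ ‖𝒜 X‖₂² ≤ (1 + δ)‖X‖_F²` for every matrix `X`
of rank at most `r`. On matrices, `‖·‖` is the Frobenius norm. -/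
def ripSet {m n l : ℕ} (𝒜 : Matrix (Fin m) (Fin n) ℝ →ₗ[ℝ] EuclideanSpace ℝ (Fin l)) (r : ℕ) :
    Set ℝ :=
  {δ | ∀ X : Matrix (Fin m) (Fin n) ℝ, X.rank ≤ r →
    (1 - δ) * ‖X‖ ^ 2 ≤ ‖𝒜 X‖ ^ 2 ∧ ‖𝒜 X‖ ^ 2 ≤ (1 + δ) * ‖X‖ ^ 2}

/-- The isometry constant `δ_r` of a linear map: the smallest element of `ripSet 𝒜 r`
(the minimum is attained, see `isLeast_ripConst`). -/
def ripConst {m n l : ℕ} (𝒜 : Matrix (Fin m) (Fin n) ℝ →ₗ[ℝ] EuclideanSpace ℝ (Fin l)) (r : ℕ) :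
    ℝ :=
  sInf (ripSet 𝒜 r)

theorem isLeast_ripConst {m n l : ℕ} (hm : 0 < m) (hn : 0 < n)
    (𝒜 : Matrix (Fin m) (Fin n) ℝ →ₗ[ℝ] EuclideanSpace ℝ (Fin l)) (r : ℕ) (hr : 0 < r) :
    IsLeast (ripSet 𝒜 r) (ripConst 𝒜 r) := by
  have hne : (ripSet 𝒜 r).Nonempty := by
    obtain ⟨C, -, hC⟩ := (LinearMap.toContinuousLinearMap 𝒜).bound
    refine ⟨1 + C ^ 2, fun X _ => ?_⟩
    have h1 : ‖𝒜 X‖ ≤ C * ‖X‖ := hC X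
    have h2 := mul_self_le_mul_self (norm_nonneg _) h1
    constructor <;> nlinarith [sq_nonneg ‖X‖, sq_nonneg (C * ‖X‖), sq_nonneg ‖𝒜 X‖]
  have hbdd : BddBelow (ripSet 𝒜 r) := by
    let X : Matrix (Fin m) (Fin n) ℝ := Matrix.vecMulVec (fun _ => 1) (fun _ => 1)
    have hX : X ≠ 0 := fun h => by
      have := congrFun (congrFun h ⟨0, hm⟩) ⟨0, hn⟩
      simp [X, Matrix.vecMulVec_apply] at this
    have hpos : 0 < ‖X‖ := norm_pos_iff.mpr hX
    refine ⟨0, fun δ hδ => ?_⟩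
    obtain ⟨h1, h2⟩ := hδ X ((Matrix.rank_vecMulVec_le _ _).trans hr)
    have h3 := h1.trans h2
    have h4 : 0 < ‖X‖ ^ 2 := by positivity
    nlinarith
  refine ⟨fun X hX => ?_, fun δ hδ => csInf_le hbdd hδ⟩
  rcases eq_or_ne X 0 with rfl | h0
  · simp
  have h4 : 0 < ‖X‖ ^ 2 := by
    have := norm_pos_iff.mpr h0
    positivity
  have hlo : 1 - ‖𝒜 X‖ ^ 2 / ‖X‖ ^ 2 ≤ ripConst 𝒜 r := le_csInf hne fun δ hδ => by
    have := (le_div_iff₀ h4).mpr (hδ X hX).1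
    linarith
  have hhi : ‖𝒜 X‖ ^ 2 / ‖X‖ ^ 2 - 1 ≤ ripConst 𝒜 r := le_csInf hne fun δ hδ => by
    have := (div_le_iff₀ h4).mpr (hδ X hX).2
    linarith
  exact ⟨(le_div_iff₀ h4).mp (by linarith), (div_le_iff₀ h4).mp (by linarith)⟩

/-- The regularized objective `J(X) = ‖X‖_* - ‖X‖_F + (1 / (2λ)) ‖𝒜 X - b‖₂²`. -/
def objective {m n l : ℕ} (𝒜 : Matrix (Fin m) (Fin n) ℝ →ₗ[ℝ] EuclideanSpace ℝ (Fin l))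
    (b : EuclideanSpace ℝ (Fin l)) (lam : ℝ) (X : Matrix (Fin m) (Fin n) ℝ) : ℝ :=
  nuclearNorm X - ‖X‖ + 1 / (2 * lam) * ‖𝒜 X - b‖ ^ 2

/-- `θ_k = (√k + √2 - 1) / (√k - √2 - 1)`. -/
def theta (k : ℕ) : ℝ := (√(k : ℝ) + √2 - 1) / (√(k : ℝ) - √2 - 1)

/-- `β₁ = δ / √((t - 1)(1 - δ²))`. -/
def beta₁ (t : ℕ) (δ : ℝ) : ℝ := δ / √(((t : ℝ) - 1) * (1 - δ ^ 2))

/-- `γ₁ = 2 / ((1 - δ)√(1 + δ))`. -/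
def gamma₁ (δ : ℝ) : ℝ := 2 / ((1 - δ) * √(1 + δ))

/-- `β̂₁ = (√2 - 1)β₁ + 1`. -/
def betaHat₁ (t : ℕ) (δ : ℝ) : ℝ := (√2 - 1) * beta₁ t δ + 1

/-- `γ̂₁ = √k γ₁ + η`. -/
def gammaHat₁ (k : ℕ) (δ η : ℝ) : ℝ := √(k : ℝ) * gamma₁ δ + η

/-- `ξ₁ = √(2k) γ₁ + β̂₁ η`. -/
def xi₁ (k t : ℕ) (δ η : ℝ) : ℝ := √(2 * (k : ℝ)) * gamma₁ δ + betaHat₁ t δ * η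

/-- `κ₁ = 1 - (β̂₁ γ̂₁ + ξ₁) / (√k (1 - β₁) γ̂₁)`. -/
def kappa₁ (k t : ℕ) (δ η : ℝ) : ℝ :=
  1 - (betaHat₁ t δ * gammaHat₁ k δ η + xi₁ k t δ η) /
    (√(k : ℝ) * (1 - beta₁ t δ) * gammaHat₁ k δ η)

/-- `C₁ = 2(β̂₁ γ̂₁ + ξ₁) / (√k (1 - β₁) γ̂₁ κ₁)`. -/
def const₁ (k t : ℕ) (δ η : ℝ) : ℝ :=
  2 * (betaHat₁ t δ * gammaHat₁ k δ η + xi₁ k t δ η) /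
    (√(k : ℝ) * (1 - beta₁ t δ) * gammaHat₁ k δ η * kappa₁ k t δ η)

/-- `C₂ = 2 ξ₁ γ̂₁ / (√k (1 - β₁) κ₁)`. -/
def const₂ (k t : ℕ) (δ η : ℝ) : ℝ :=
  2 * xi₁ k t δ η * gammaHat₁ k δ η / (√(k : ℝ) * (1 - beta₁ t δ) * kappa₁ k t δ η)

end LowRankRecovery

end

/-! Put `H = X - X₀`. Comparing `J(X)` with `J(X₀)` and using the triangle inequality for both norms
gives `‖H‖_* + ‖𝒜 H‖² / (2λ) ≤ 2‖X₀‖_* + ‖H‖_F + η‖𝒜 H‖` (`nuclearNorm_sub_add_le_of_isMinOn`). In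
the singular bases of `H` the isometry property becomes one for sparse vectors, applied to the
vector `σ` of singular values. Let `q` be the sum of all but the `k` largest of them. The `k`
largest have ℓ² norm at most `β₁ q/√k + γ₁‖𝒜 H‖` (`SparseRIP.sqrt_sum_sq_le`), and the rest add at
most `q/√k` to `‖H‖_F`. The head bound rests on `SparseRIP.sq_le`: the small entries of the tail
form a point of a polytope whose relevant extreme points are sparse, and a linear functional does
not increase on passing to a suitable one. Since `q ≤ ‖H‖_*`, the two estimates form a closed system
in `‖H‖_F`, `q` and `‖𝒜 H‖`. It can be solved for `‖H‖_F` because `κ₁ > 0`, which follows from the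
hypothesis on `δ` in the form `β₁ θ_k < 1`. -/

namespace LowRankRecovery

/-! ### Sparse vectors and the restricted isometry property -/

/-- A linear functional on the polytope `{v | 0 ≤ v ≤ α, ∑ v ≤ s α}` is minimised at a multiple
of the indicator function of a set of at most `s` indices. -/
theorem exists_subset_mul_sum_le_sum_mul {ι : Type*} [DecidableEq ι] (T : Finset ι) (s : ℕ)
    {α : ℝ} (v g : ι → ℝ) (hv0 : ∀ i ∈ T, 0 ≤ v i) (hv1 : ∀ i ∈ T, v i ≤ α)
    (hsum : ∑ i ∈ T, v i ≤ s * α) :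
    ∃ S ⊆ T, S.card ≤ s ∧ α * ∑ i ∈ S, g i ≤ ∑ i ∈ T, g i * v i := by
  obtain ⟨S, hS, hmin⟩ := Finset.exists_min_image (T.powerset.filter fun S => S.card ≤ s)
    (fun S => ∑ i ∈ S, g i) ⟨∅, by simp⟩
  simp only [Finset.mem_filter, Finset.mem_powerset] at hS hmin
  obtain ⟨hST, hcard⟩ := hS
  have hneg : ∀ i ∈ S, g i ≤ 0 := fun i hi => by
    have h1 := hmin (S.erase i) ⟨(Finset.erase_subset _ _).trans hST,
      (Finset.card_erase_le).trans hcard⟩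
    have h2 := Finset.add_sum_erase S g hi
    linarith
  -- `τ` is a Lagrange multiplier for the constraint on `∑ v`: shifting `g` by `τ` makes it
  -- nonpositive on `S` and nonnegative off `S`, so the bounds on `v` can be applied termwise.
  suffices h : ∃ τ : ℝ, (∀ i ∈ S, g i ≤ τ) ∧ (∀ j ∈ T \ S, τ ≤ g j) ∧
      τ * (S.card * α) ≤ τ * ∑ i ∈ T, v i by
    obtain ⟨τ, h1, h2, h3⟩ := h
    refine ⟨S, hST, hcard, ?_⟩
    have e1 : ∑ i ∈ T, g i * v i = ∑ i ∈ T, (g i - τ) * v i + τ * ∑ i ∈ T, v i := by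
      rw [Finset.mul_sum, ← Finset.sum_add_distrib]
      exact Finset.sum_congr rfl fun i _ => by ring
    have e2 : ∑ i ∈ S, (g i - τ) * α ≤ ∑ i ∈ S, (g i - τ) * v i :=
      Finset.sum_le_sum fun i hi => by nlinarith [h1 i hi, hv1 i (hST hi)]
    have e3 : 0 ≤ ∑ i ∈ T \ S, (g i - τ) * v i :=
      Finset.sum_nonneg fun i hi =>
        mul_nonneg (by linarith [h2 i hi]) (hv0 i (Finset.mem_sdiff.1 hi).1)
    have e4 := Finset.sum_sdiff (f := fun i => (g i - τ) * v i) hST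
    have e5 : ∑ i ∈ S, (g i - τ) * α = α * ∑ i ∈ S, g i - τ * (S.card * α) := by
      rw [← Finset.sum_mul, Finset.sum_sub_distrib]
      simp only [Finset.sum_const, nsmul_eq_mul]
      ring
    linarith
  rcases hcard.lt_or_eq with hlt | heq
  · refine ⟨0, hneg, fun j hj => ?_, by simp⟩
    obtain ⟨hjT, hjS⟩ := Finset.mem_sdiff.1 hj
    have h1 := hmin (insert j S) ⟨Finset.insert_subset hjT hST,
      (Finset.card_insert_le _ _).trans hlt⟩
    rw [Finset.sum_insert hjS] at h1
    linarith
  -- For `s = 0` the sum of `v` vanishes and the sign of `τ` is irrelevant; otherwise `τ` is the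
  -- largest value of `g` on `S`, by an exchange argument.
  · rcases S.eq_empty_or_nonempty with rfl | hne
    · simp only [Finset.card_empty] at heq
      subst heq
      have hv : ∑ i ∈ T, v i = 0 :=
        le_antisymm (by simpa using hsum) (Finset.sum_nonneg hv0)
      rcases T.eq_empty_or_nonempty with rfl | hT
      · exact ⟨0, by simp⟩
      · obtain ⟨j, hj, hjmin⟩ := Finset.exists_min_image T g hT
        exact ⟨g j, by simp, fun i hi => hjmin i (by simpa using hi), by simp [hv]⟩
    · obtain ⟨i, hi, hmax⟩ := Finset.exists_max_image S g hne
      refine ⟨g i, hmax, fun j hj => ?_, ?_⟩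
      · obtain ⟨hjT, hjS⟩ := Finset.mem_sdiff.1 hj
        have hj' : j ∉ S.erase i := fun h => hjS (Finset.mem_of_mem_erase h)
        have h1 := hmin (insert j (S.erase i))
          ⟨Finset.insert_subset hjT ((Finset.erase_subset _ _).trans hST), by
            rw [Finset.card_insert_of_notMem hj', Finset.card_erase_of_mem hi]
            have := Finset.card_pos.2 hne
            omega⟩
        rw [Finset.sum_insert hj'] at h1
        have h2 := Finset.add_sum_erase S g hi
        linarith
      · rw [heq]
        exact mul_le_mul_of_nonpos_left hsum (hneg i hi)

/-- The restricted isometry property of order `r`, with constant `δ`, for a linear map on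
coordinate vectors. -/
def SparseRIP {ι E : Type*} [Fintype ι] [NormedAddCommGroup E] [InnerProductSpace ℝ E]
    (B : (ι → ℝ) →ₗ[ℝ] E) (r : ℕ) (δ : ℝ) : Prop :=
  ∀ x : ι → ℝ, ∀ S : Finset ι, S.card ≤ r → (∀ i ∉ S, x i = 0) →
    (1 - δ) * ∑ i, x i ^ 2 ≤ ‖B x‖ ^ 2 ∧ ‖B x‖ ^ 2 ≤ (1 + δ) * ∑ i, x i ^ 2

/-- Both vectors on the right are combinations of `w` and `u`, hence sparse when these are: the
lower isometry bound applies to the first and the upper one to the second. -/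
theorem inner_add_eq_norm_sq_sub_norm_sq {E : Type*} [NormedAddCommGroup E]
    [InnerProductSpace ℝ E] (w u : E) (μ : ℝ) :
    μ * (1 - μ) * inner ℝ w (w + u) =
      1 / 4 * ‖w + μ • u‖ ^ 2 - ‖(1 / 2 - μ) • w - (μ / 2) • u‖ ^ 2 := by
  rw [norm_add_sq_real, norm_sub_sq_real, inner_add_right, real_inner_self_eq_norm_sq]
  simp only [norm_smul, inner_smul_left, inner_smul_right, mul_pow, Real.norm_eq_abs, sq_abs,
    RCLike.conj_to_real]
  ring

section RIP

variable {ι E : Type*} [Fintype ι] [DecidableEq ι] [NormedAddCommGroup E] [InnerProductSpace ℝ E]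
  {B : (ι → ℝ) →ₗ[ℝ] E} {r : ℕ} {δ : ℝ}

theorem SparseRIP.le_inner (hB : SparseRIP B r δ) (hδ0 : 0 ≤ δ) {w u : ι → ℝ}
    {W S : Finset ι} (hWS : Disjoint W S) (hcard : W.card + S.card ≤ r)
    (hw : ∀ i ∉ W, w i = 0) (hu : ∀ i ∉ S, u i = 0) :
    (1 - δ ^ 2) * ∑ i, w i ^ 2 - δ ^ 2 * ∑ i, u i ^ 2 ≤ 2 * inner ℝ (B w) (B (w + u)) := by
  have hzero : ∀ i, w i * u i = 0 := fun i => by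
    by_cases hi : i ∈ W
    · rw [hu i (Finset.disjoint_left.1 hWS hi), mul_zero]
    · rw [hw i hi, zero_mul]
  have hsq : ∀ a b : ℝ, ∑ i, (a • w + b • u) i ^ 2 =
      a ^ 2 * ∑ i, w i ^ 2 + b ^ 2 * ∑ i, u i ^ 2 := fun a b => by
    rw [Finset.mul_sum, Finset.mul_sum, ← Finset.sum_add_distrib]
    refine Finset.sum_congr rfl fun i _ => ?_
    simp only [Pi.add_apply, Pi.smul_apply, smul_eq_mul]
    linear_combination 2 * a * b * hzero i
  have hrip : ∀ a b : ℝ, _ := fun a b => hB (a • w + b • u) (W ∪ S)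
    ((Finset.card_union_le _ _).trans hcard) fun i hi => by
      rw [Finset.mem_union, not_or] at hi
      simp [hw i hi.1, hu i hi.2]
  simp only [hsq, map_add, map_smul] at hrip
  have key : ∀ μ : ℝ, (1 - δ) / 4 * (∑ i, w i ^ 2 + μ ^ 2 * ∑ i, u i ^ 2) -
      (1 + δ) * ((1 / 2 - μ) ^ 2 * ∑ i, w i ^ 2 + μ ^ 2 / 4 * ∑ i, u i ^ 2) ≤
      μ * (1 - μ) * inner ℝ (B w) (B (w + u)) := fun μ => by
    rw [map_add, inner_add_eq_norm_sq_sub_norm_sq]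
    have h1 := (hrip 1 μ).1
    have h2 := (hrip (1 / 2 - μ) (-(μ / 2))).2
    rw [one_smul] at h1
    rw [neg_smul, ← sub_eq_add_neg] at h2
    nlinarith
  -- The choice of `μ` below degenerates at `δ = 0`, where `μ = 1/2` serves.
  rcases hδ0.eq_or_lt with rfl | hpos
  · have h1 := key (1 / 2)
    have h2 : 0 ≤ ∑ i, w i ^ 2 := Finset.sum_nonneg fun i _ => sq_nonneg _
    nlinarith
  -- This `μ` minimizes the ratio of the coefficient of `‖u‖²` to that of `‖w‖²`, giving `δ² / (1 -
  -- δ²)`.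
  · have h1 := key (δ / (1 + δ))
    have h0 : (1 + δ) ≠ 0 := by positivity
    have h2 := mul_le_mul_of_nonneg_left h1 (show 0 ≤ 2 * (1 + δ) ^ 2 / δ by positivity)
    have e1 : 2 * (1 + δ) ^ 2 / δ * (δ / (1 + δ) * (1 - δ / (1 + δ)) *
        inner ℝ (B w) (B (w + u))) = 2 * inner ℝ (B w) (B (w + u)) := by
      field_simp
      ring
    rw [e1] at h2
    refine le_trans (le_of_eq ?_) h2
    field_simp
    ring

/-- Here `x = ‖w‖`, where `w` is `σ` restricted to `S` and to the large entries outside it. The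
inequality stays quadratic in `x`, to be solved later. -/
theorem SparseRIP.sq_le {k t : ℕ} (hk : 0 < k) (ht : 1 < t) (hB : SparseRIP B (t * k) δ)
    (hδ0 : 0 ≤ δ) {σ : ι → ℝ} (hσ : ∀ i, 0 ≤ σ i) {S : Finset ι} (hS : S.card ≤ k) :
    ∃ x : ℝ, 0 ≤ x ∧ ∑ i ∈ S, σ i ^ 2 ≤ x ^ 2 ∧
      (1 - δ ^ 2) * x ^ 2 ≤ δ ^ 2 * ((∑ i ∈ Sᶜ, σ i) ^ 2 / (k * (t - 1))) +
        2 * √(1 + δ) * x * ‖B σ‖ := by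
  set q := ∑ i ∈ Sᶜ, σ i with hq
  have hq0 : 0 ≤ q := Finset.sum_nonneg fun i _ => hσ i
  have hK : (0 : ℝ) < k * (t - 1) := by
    have : (1 : ℝ) < t := by exact_mod_cast ht
    have : (0 : ℝ) < k := by exact_mod_cast hk
    nlinarith
  -- With this threshold at most `k(t - 1)` entries outside `S` exceed `α`, and the others sum to at
  -- most `α` times the number of places left in a budget of `tk` indices.
  obtain ⟨α, hα⟩ : ∃ α, α = q / (k * ((t : ℝ) - 1)) := ⟨_, rfl⟩
  have hα0 : 0 ≤ α := hα ▸ by positivity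
  have hqα : q = k * ((t : ℝ) - 1) * α := by
    rw [hα, mul_comm, div_mul_cancel₀ _ hK.ne']
  set S₁ := Sᶜ.filter fun i => α < σ i with hS₁
  set T := Sᶜ.filter fun i => ¬ α < σ i with hT
  have hsplit : ∑ i ∈ S₁, σ i + ∑ i ∈ T, σ i = q := Finset.sum_filter_add_sum_filter_not _ _ _
  have hS₁sum : S₁.card * α ≤ ∑ i ∈ S₁, σ i := by
    rw [← nsmul_eq_mul]
    exact Finset.card_nsmul_le_sum _ _ _ fun i hi => (Finset.mem_filter.1 hi).2.le
  have hTsum0 : 0 ≤ ∑ i ∈ T, σ i := Finset.sum_nonneg fun i _ => hσ i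
  have hcast : ((k * (t - 1) : ℕ) : ℝ) = k * ((t : ℝ) - 1) := by
    rw [Nat.cast_mul, Nat.cast_sub ht.le, Nat.cast_one]
  have hS₁card : S₁.card ≤ k * (t - 1) := by
    rcases hα0.eq_or_lt with h0 | hpos
    · have : S₁ = ∅ := by
        refine Finset.filter_eq_empty_iff.2 fun i hi hlt => ?_
        have h1 : q = 0 := by rw [hqα, ← h0, mul_zero]
        have h2 := (Finset.sum_eq_zero_iff_of_nonneg fun i _ => hσ i).1 h1 i hi
        linarith
      simp [this]
    · have h1 : (S₁.card : ℝ) * α ≤ (k * (t - 1) : ℕ) * α := by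
        rw [hcast, ← hqα]
        linarith
      exact_mod_cast le_of_mul_le_mul_right h1 hpos
  obtain ⟨w, hw⟩ : ∃ w : ι → ℝ, w = fun i => if i ∈ S ∪ S₁ then σ i else 0 := ⟨_, rfl⟩
  have hTsum : ∑ i ∈ T, σ i ≤ (k * (t - 1) - S₁.card : ℕ) * α := by
    rw [Nat.cast_sub hS₁card, hcast, sub_mul, ← hqα]
    linarith
  -- The functional is `y ↦ ⟨B w, B y⟩`; its minimizer `u` replaces `σ - w`, and `w + u` is
  -- `tk`-sparse.
  obtain ⟨S₂, hS₂T, hS₂card, hS₂⟩ := exists_subset_mul_sum_le_sum_mul T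
    (k * (t - 1) - S₁.card) σ (fun i => inner ℝ (B w) (B (Pi.single i 1))) (fun i _ => hσ i)
    (fun i hi => not_lt.1 (Finset.mem_filter.1 hi).2) hTsum
  obtain ⟨u, hu⟩ : ∃ u : ι → ℝ, u = fun i => if i ∈ S₂ then α else 0 := ⟨_, rfl⟩
  have hinner : ∀ (A : Finset ι) (y : ι → ℝ), (∀ i ∉ A, y i = 0) →
      inner ℝ (B w) (B y) = ∑ i ∈ A, inner ℝ (B w) (B (Pi.single i 1)) * y i := by
    intro A y hy
    have h1 : y = ∑ i ∈ A, y i • Pi.single i (1 : ℝ) := by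
      ext j
      by_cases hj : j ∈ A
      · simp [Finset.sum_apply, Pi.single_apply, hj]
      · simp [Finset.sum_apply, Pi.single_apply, hj, hy j hj]
    conv_lhs => rw [h1]
    rw [map_sum, inner_sum]
    refine Finset.sum_congr rfl fun i _ => ?_
    rw [map_smul, inner_smul_right, mul_comm]
  have hdisjT : ∀ i ∈ T, i ∉ S ∪ S₁ := fun i hi h => by
    rw [hT, Finset.mem_filter, Finset.mem_compl] at hi
    rw [Finset.mem_union, hS₁, Finset.mem_filter] at h
    tauto
  have hcoverT : ∀ i ∉ T, i ∈ S ∪ S₁ := fun i hi => by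
    rw [hT, Finset.mem_filter, Finset.mem_compl] at hi
    rw [Finset.mem_union, hS₁, Finset.mem_filter, Finset.mem_compl]
    tauto
  have hle : inner ℝ (B w) (B u) ≤ inner ℝ (B w) (B (σ - w)) := by
    rw [hinner S₂ u fun i hi => by simp [hu, hi], hinner T (σ - w) fun i hi => by
      simp only [hw, Pi.sub_apply, if_pos (hcoverT i hi), sub_self]]
    calc _ = α * ∑ i ∈ S₂, inner ℝ (B w) (B (Pi.single i 1)) := by
          rw [Finset.mul_sum]
          refine Finset.sum_congr rfl fun i hi => ?_
          simp only [hu, if_pos hi, mul_comm]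
      _ ≤ _ := hS₂
      _ = _ := by
          refine Finset.sum_congr rfl fun i hi => ?_
          simp only [hw, Pi.sub_apply, if_neg (hdisjT i hi), sub_zero]
  have hWcard : (S ∪ S₁).card ≤ k + S₁.card :=
    (Finset.card_union_le _ _).trans (by omega)
  have htk : t * k = k + k * (t - 1) := by
    obtain ⟨t, rfl⟩ : ∃ t', t = t' + 1 := ⟨t - 1, by omega⟩
    simp only [Nat.add_sub_cancel]
    ring
  have hw0 : ∀ i ∉ S ∪ S₁, w i = 0 := fun i hi => by simp only [hw, if_neg hi]
  have hmain := hB.le_inner hδ0 (W := S ∪ S₁) (S := S₂) (w := w) (u := u)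
    (Finset.disjoint_right.2 fun i hi => hdisjT i (hS₂T hi)) (by omega) hw0
    fun i hi => by simp only [hu, if_neg hi]
  have husq : ∑ i, u i ^ 2 ≤ q ^ 2 / (k * (t - 1)) := by
    have h1 : ∑ i, u i ^ 2 = S₂.card * α ^ 2 := by
      simp only [hu, ite_pow, ne_eq, OfNat.ofNat_ne_zero, not_false_eq_true, zero_pow,
        Finset.sum_ite_mem, Finset.univ_inter, Finset.sum_const, nsmul_eq_mul]
    have h2 : (S₂.card : ℝ) ≤ k * ((t : ℝ) - 1) := by
      rw [← hcast]
      exact_mod_cast hS₂card.trans (Nat.sub_le _ _)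
    rw [h1, le_div_iff₀ hK]
    calc S₂.card * α ^ 2 * (k * ((t : ℝ) - 1))
        ≤ k * ((t : ℝ) - 1) * α ^ 2 * (k * ((t : ℝ) - 1)) := by gcongr
      _ = q ^ 2 := by rw [hqα]; ring
  have hx0 : 0 ≤ ∑ i, w i ^ 2 := Finset.sum_nonneg fun i _ => sq_nonneg _
  refine ⟨√(∑ i, w i ^ 2), Real.sqrt_nonneg _, ?_, ?_⟩
  · rw [Real.sq_sqrt hx0]
    calc ∑ i ∈ S, σ i ^ 2 = ∑ i ∈ S, w i ^ 2 := Finset.sum_congr rfl fun i hi => by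
          simp only [hw, if_pos (Finset.mem_union_left _ hi)]
      _ ≤ _ := Finset.sum_le_sum_of_subset_of_nonneg (Finset.subset_univ _)
          fun i _ _ => sq_nonneg _
  · rw [Real.sq_sqrt hx0]
    have hBw : ‖B w‖ ≤ √(1 + δ) * √(∑ i, w i ^ 2) := by
      rw [← Real.sqrt_mul (by positivity)]
      exact Real.le_sqrt_of_sq_le (hB w (S ∪ S₁) (by omega) hw0).2
    have hcs : inner ℝ (B w) (B (w + u)) ≤ √(1 + δ) * √(∑ i, w i ^ 2) * ‖B σ‖ := by
      calc inner ℝ (B w) (B (w + u)) ≤ inner ℝ (B w) (B w + B (σ - w)) := by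
            rw [map_add, inner_add_right, inner_add_right]
            gcongr
        _ = inner ℝ (B w) (B σ) := by rw [← map_add, add_sub_cancel]
        _ ≤ ‖B w‖ * ‖B σ‖ := real_inner_le_norm _ _
        _ ≤ _ := by gcongr
    have := mul_le_mul_of_nonneg_left husq (sq_nonneg δ)
    linarith

end RIP

/-! ### Singular values and the nuclear norm -/

open Matrix

theorem norm_sq_eq_trace {m n : ℕ} (X : Matrix (Fin m) (Fin n) ℝ) :
    ‖X‖ ^ 2 = (Xᵀ * X).trace := by
  rw [frobenius_norm_def, ← Real.sqrt_eq_rpow, Real.sq_sqrt (by positivity)]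
  simp only [trace, diag_apply, mul_apply, transpose_apply, Real.rpow_ofNat, Real.norm_eq_abs,
    sq_abs]
  rw [Finset.sum_comm]
  simp only [sq]

section Synthesis

variable {m n r : ℕ} {U : Matrix (Fin m) (Fin r) ℝ} {V : Matrix (Fin n) (Fin r) ℝ}

theorem norm_sq_mul_diagonal_mul (hU : Uᵀ * U = 1) (hV : Vᵀ * V = 1) (x : Fin r → ℝ) :
    ‖U * diagonal x * Vᵀ‖ ^ 2 = ∑ i, x i ^ 2 := by
  rw [norm_sq_eq_trace]
  have : (U * diagonal x * Vᵀ)ᵀ * (U * diagonal x * Vᵀ) =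
      V * (diagonal x * diagonal x * Vᵀ) := by
    simp only [transpose_mul, transpose_transpose, diagonal_transpose, Matrix.mul_assoc]
    rw [← Matrix.mul_assoc Uᵀ, hU, Matrix.one_mul]
  rw [this, trace_mul_comm, Matrix.mul_assoc, hV, Matrix.mul_one, diagonal_mul_diagonal,
    trace_diagonal]
  simp only [sq]

theorem rank_mul_diagonal_mul_le (x : Fin r → ℝ) (S : Finset (Fin r))
    (hx : ∀ i ∉ S, x i = 0) : (U * diagonal x * Vᵀ).rank ≤ S.card := by
  refine (rank_mul_le_left _ _).trans ((rank_mul_le_right _ _).trans ?_)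
  rw [rank_diagonal, Fintype.card_subtype]
  exact Finset.card_le_card fun i hi => by
    by_contra h
    exact (Finset.mem_filter.1 hi).2 (hx i h)

/-- The linear map `x ↦ U diag(x) Vᵀ`. -/
def synthesis (U : Matrix (Fin m) (Fin r) ℝ) (V : Matrix (Fin n) (Fin r) ℝ) :
    (Fin r → ℝ) →ₗ[ℝ] Matrix (Fin m) (Fin n) ℝ where
  toFun x := U * diagonal x * Vᵀ
  map_add' x y := by rw [← Matrix.add_mul, ← Matrix.mul_add, diagonal_add]; rfl
  map_smul' c x := by
    rw [diagonal_smul, Matrix.mul_smul, Matrix.smul_mul, RingHom.id_apply]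

theorem sparseRIP_comp_synthesis {l d : ℕ} {δ : ℝ}
    {𝒜 : Matrix (Fin m) (Fin n) ℝ →ₗ[ℝ] EuclideanSpace ℝ (Fin l)} (hδ : δ ∈ ripSet 𝒜 d)
    (hU : Uᵀ * U = 1) (hV : Vᵀ * V = 1) : SparseRIP (𝒜 ∘ₗ synthesis U V) d δ := by
  intro x S hS hx
  rw [← norm_sq_mul_diagonal_mul hU hV]
  exact hδ _ ((rank_mul_diagonal_mul_le x S hx).trans hS)

end Synthesis

/-- The singular value decomposition of a real matrix, restricted to its nonzero singular
values. -/
theorem exists_svd {m n : ℕ} (X : Matrix (Fin m) (Fin n) ℝ) :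
    ∃ (r : ℕ) (U : Matrix (Fin m) (Fin r) ℝ) (V : Matrix (Fin n) (Fin r) ℝ) (σ : Fin r → ℝ),
      Uᵀ * U = 1 ∧ Vᵀ * V = 1 ∧ (∀ i, 0 ≤ σ i) ∧ Antitone σ ∧
      X = U * diagonal σ * Vᵀ ∧ nuclearNorm X = ∑ i, σ i := by
  set T := toEuclideanLin X with hT
  have hfin : Module.finrank ℝ (EuclideanSpace ℝ (Fin n)) = n := by simp
  have hfinm : Module.finrank ℝ (EuclideanSpace ℝ (Fin m)) = m := by simp
  set r := Module.finrank ℝ (LinearMap.range T) with hr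
  have hrn : r ≤ n := hfin ▸ LinearMap.finrank_range_le T
  have hrm : r ≤ m := hfinm ▸ Submodule.finrank_le _
  set e := T.isSymmetric_adjoint_comp_self.eigenvectorBasis hfin with he
  have hTT : ∀ i j : Fin n, inner ℝ (T (e i)) (T (e j)) =
      if i = j then T.singularValues i ^ 2 else 0 := fun i j => by
    rw [← LinearMap.adjoint_inner_right, ← LinearMap.comp_apply, he,
      LinearMap.IsSymmetric.apply_eigenvectorBasis, inner_smul_right, ← he,
      orthonormal_iff_ite.1 e.orthonormal]
    split_ifs with h
    · rw [T.sq_singularValues_fin hfin, h]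
      simp
    · simp
  have hpos : ∀ i : Fin r, 0 < T.singularValues i := fun i =>
    T.singularValues_pos_iff_lt_finrank_range.2 i.2
  set c : Fin r → Fin n := Fin.castLE hrn with hc
  have hci : Function.Injective c := Fin.castLE_injective hrn
  -- Only the `r` nonzero singular values are kept, so normalizing the images of the eigenvectors of
  -- `TᵀT` is legitimate and no completion to a basis is needed.
  set U : Matrix (Fin m) (Fin r) ℝ := of fun a i => (T.singularValues i)⁻¹ * T (e (c i)) a with hU
  set V : Matrix (Fin n) (Fin r) ℝ := of fun a i => e (c i) a with hV
  refine ⟨r, U, V, fun i => T.singularValues i, ?_, ?_, fun i => (hpos i).le,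
    fun i j hij => T.singularValues_antitone hij, ?_, ?_⟩
  · ext i j
    have h1 := hTT (c i) (c j)
    rw [EuclideanSpace.inner_eq_star_dotProduct] at h1
    simp only [dotProduct, Pi.star_apply, star_trivial] at h1
    have h2 : (Uᵀ * U) i j = (T.singularValues i)⁻¹ * (T.singularValues j)⁻¹ *
        ∑ a, T (e (c j)) a * T (e (c i)) a := by
      rw [mul_apply, Finset.mul_sum]
      refine Finset.sum_congr rfl fun a _ => ?_
      simp only [hU, transpose_apply, of_apply]
      ring
    rw [h2, h1, one_apply]
    by_cases hij : i = j
    · subst hij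
      have := (hpos i).ne'
      simp only [if_true, hc, Fin.val_castLE]
      field_simp
    · rw [if_neg fun h => hij (hci h), if_neg hij, mul_zero]
  · ext i j
    have h1 := orthonormal_iff_ite.1 e.orthonormal (c i) (c j)
    rw [EuclideanSpace.inner_eq_star_dotProduct] at h1
    simp only [dotProduct, Pi.star_apply, star_trivial] at h1
    rw [one_apply, mul_apply]
    simp only [hV, transpose_apply, of_apply]
    simp only [mul_comm (e (c i) _)]
    rw [h1]
    simp only [hci.eq_iff]
  · have hlin : T = toEuclideanLin (U * diagonal (fun i : Fin r => T.singularValues i) * Vᵀ) := by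
      refine e.toBasis.ext fun j => ?_
      rw [OrthonormalBasis.coe_toBasis]
      change T (e j) = WithLp.toLp 2 (_ *ᵥ (e j).ofLp)
      have hVe : Vᵀ *ᵥ (e j).ofLp = fun i => if c i = j then 1 else 0 := by
        ext i
        have h1 := orthonormal_iff_ite.1 e.orthonormal (c i) j
        rw [EuclideanSpace.inner_eq_star_dotProduct] at h1
        simp only [dotProduct, Pi.star_apply, star_trivial] at h1
        rw [← h1]
        change ∑ a, e (c i) a * e j a = _
        exact Finset.sum_congr rfl fun a _ => mul_comm _ _
      rw [← mulVec_mulVec, hVe, ← mulVec_mulVec, funext (mulVec_diagonal _ _)]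
      ext a
      change T (e j) a = ∑ i, U a i * _
      simp only [hU, of_apply, mul_ite, mul_one, mul_zero]
      by_cases hj : (j : ℕ) < r
      · have hcj : ∀ i, c i = j ↔ i = ⟨j, hj⟩ := fun i => by
          simp [hc, Fin.ext_iff]
        have h0 := (hpos ⟨j, hj⟩).ne'
        have hcj' := (hcj ⟨j, hj⟩).2 rfl
        simp only [hcj, Finset.sum_ite_eq', Finset.mem_univ, if_true]
        rw [hcj']
        field_simp
      · have hcj : ∀ i, c i ≠ j := fun i h => hj (h ▸ i.2)
        have hz : T (e j) = 0 := by
          have h1 := hTT j j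
          rw [if_pos rfl, T.singularValues_eq_zero_iff_le_finrank_range.2 (not_lt.1 hj)] at h1
          exact (inner_self_eq_zero (𝕜 := ℝ)).1 (h1.trans (by norm_num))
        simp [hcj, hz]
    exact toEuclideanLin.injective hlin
  · rw [nuclearNorm, Fin.sum_univ_eq_sum_range (fun i => T.singularValues i) r]
    refine (Finset.sum_subset (Finset.range_subset_range.2 (le_min hrm hrn)) fun i _ hi => ?_).symm
    rw [Finset.mem_range, not_lt] at hi
    exact T.singularValues_eq_zero_iff_le_finrank_range.2 hi

/-- Bessel's inequality: expand the square of the residual `a - U Uᵀ a`. -/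
theorem dotProduct_transpose_mulVec_self_le {m r : ℕ} {U : Matrix (Fin m) (Fin r) ℝ}
    (hU : Uᵀ * U = 1) (a : Fin m → ℝ) : (Uᵀ *ᵥ a) ⬝ᵥ (Uᵀ *ᵥ a) ≤ a ⬝ᵥ a := by
  have h1 : 0 ≤ (a - U *ᵥ (Uᵀ *ᵥ a)) ⬝ᵥ (a - U *ᵥ (Uᵀ *ᵥ a)) :=
    Finset.sum_nonneg fun i _ => mul_self_nonneg _
  have h2 : ∀ y, a ⬝ᵥ (U *ᵥ y) = (Uᵀ *ᵥ a) ⬝ᵥ y := fun y => by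
    rw [dotProduct_mulVec, mulVec_transpose]
  have h3 : (U *ᵥ (Uᵀ *ᵥ a)) ⬝ᵥ (U *ᵥ (Uᵀ *ᵥ a)) = (Uᵀ *ᵥ a) ⬝ᵥ (Uᵀ *ᵥ a) := by
    rw [dotProduct_mulVec, ← mulVec_transpose, mulVec_mulVec, hU, one_mulVec]
  rw [sub_dotProduct, dotProduct_sub, dotProduct_sub, h3, dotProduct_comm (U *ᵥ _) a, h2] at h1
  linarith

/-- Expanding `X` in its singular vectors turns the trace into `∑ σⱼ ⟨Uᵀ aⱼ, Vᵀ bⱼ⟩`, and each inner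
product is at most 1 in modulus by Bessel. -/
theorem abs_trace_transpose_mul_mul_le_nuclearNorm {m n r : ℕ} {U : Matrix (Fin m) (Fin r) ℝ}
    {V : Matrix (Fin n) (Fin r) ℝ} (hU : Uᵀ * U = 1) (hV : Vᵀ * V = 1)
    (X : Matrix (Fin m) (Fin n) ℝ) : |(Uᵀ * X * V).trace| ≤ nuclearNorm X := by
  obtain ⟨d, A, B, σ, hA, hB, hσ, -, hX, hN⟩ := exists_svd X
  have h1 : (Uᵀ * X * V).trace = ∑ j, σ j * ((Uᵀ *ᵥ A.col j) ⬝ᵥ (Vᵀ *ᵥ B.col j)) := by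
    have : Uᵀ * X * V = (Uᵀ * A) * (diagonal σ * (Bᵀ * V)) := by
      rw [hX]
      simp only [Matrix.mul_assoc]
    rw [this, trace_mul_comm, Matrix.mul_assoc, trace]
    refine Finset.sum_congr rfl fun j _ => ?_
    rw [diag_apply, diagonal_mul, mul_apply, dotProduct]
    congr 1
    refine Finset.sum_congr rfl fun i _ => ?_
    rw [mul_comm]
    simp only [mul_apply, mulVec, dotProduct, transpose_apply, col_apply]
    congr 1
    exact Finset.sum_congr rfl fun _ _ => mul_comm _ _
  have hcol : ∀ {p : ℕ} {C : Matrix (Fin p) (Fin d) ℝ}, Cᵀ * C = 1 → ∀ j,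
      C.col j ⬝ᵥ C.col j = 1 := fun {p C} hC j => by
    have := congrFun (congrFun hC j) j
    rwa [mul_apply, one_apply_eq] at this
  rw [h1, hN]
  refine (Finset.abs_sum_le_sum_abs _ _).trans (Finset.sum_le_sum fun j _ => ?_)
  rw [abs_mul, abs_of_nonneg (hσ j)]
  refine mul_le_of_le_one_right (hσ j) ?_
  set x := Uᵀ *ᵥ A.col j with hx
  set y := Vᵀ *ᵥ B.col j with hy
  have hxx : x ⬝ᵥ x ≤ 1 := hcol hA j ▸ dotProduct_transpose_mulVec_self_le hU _
  have hyy : y ⬝ᵥ y ≤ 1 := hcol hB j ▸ dotProduct_transpose_mulVec_self_le hV _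
  have hp : 0 ≤ (x + y) ⬝ᵥ (x + y) := Finset.sum_nonneg fun i _ => mul_self_nonneg _
  have hm : 0 ≤ (x - y) ⬝ᵥ (x - y) := Finset.sum_nonneg fun i _ => mul_self_nonneg _
  rw [add_dotProduct, dotProduct_add, dotProduct_add, dotProduct_comm y x] at hp
  rw [sub_dotProduct, dotProduct_sub, dotProduct_sub, dotProduct_comm y x] at hm
  rw [abs_le]
  constructor <;> linarith

theorem nuclearNorm_nonneg {m n : ℕ} (X : Matrix (Fin m) (Fin n) ℝ) : 0 ≤ nuclearNorm X :=
  Finset.sum_nonneg fun _ _ => LinearMap.singularValues_nonneg _ _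

/-- The singular factors of `X - Y` attain its nuclear norm as a trace; the trace is linear and is
bounded on `X` and `Y` by duality. -/
theorem nuclearNorm_sub_le {m n : ℕ} (X Y : Matrix (Fin m) (Fin n) ℝ) :
    nuclearNorm (X - Y) ≤ nuclearNorm X + nuclearNorm Y := by
  obtain ⟨d, A, B, σ, hA, hB, -, -, hX, hN⟩ := exists_svd (X - Y)
  have h1 : (Aᵀ * (X - Y) * B).trace = ∑ i, σ i := by
    rw [hX, Matrix.mul_assoc A, ← Matrix.mul_assoc, hA, Matrix.one_mul, Matrix.mul_assoc, hB,
      Matrix.mul_one, trace_diagonal]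
  rw [Matrix.mul_sub, Matrix.sub_mul, trace_sub] at h1
  rw [hN, ← h1]
  have hx := abs_le.1 (abs_trace_transpose_mul_mul_le_nuclearNorm hA hB X)
  have hy := abs_le.1 (abs_trace_transpose_mul_mul_le_nuclearNorm hA hB Y)
  linarith [hx.2, hy.1]

theorem ripConst_mem_and_nonneg {m n l : ℕ}
    (𝒜 : Matrix (Fin m) (Fin n) ℝ →ₗ[ℝ] EuclideanSpace ℝ (Fin l)) {r : ℕ} (hr : 0 < r) :
    ripConst 𝒜 r ∈ ripSet 𝒜 r ∧ 0 ≤ ripConst 𝒜 r := by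
  by_cases hmn : 0 < m ∧ 0 < n
  · have hmem := (isLeast_ripConst hmn.1 hmn.2 𝒜 r hr).1
    refine ⟨hmem, ?_⟩
    obtain ⟨X, hX⟩ : ∃ X : Matrix (Fin m) (Fin n) ℝ, X = vecMulVec (fun _ => 1) (fun _ => 1) :=
      ⟨_, rfl⟩
    have hX0 : X ≠ 0 := fun h => by
      have := congrFun (congrFun h ⟨0, hmn.1⟩) ⟨0, hmn.2⟩
      simp [hX, vecMulVec_apply] at this
    have hpos : 0 < ‖X‖ ^ 2 := by
      have := norm_pos_iff.2 hX0
      positivity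
    obtain ⟨h1, h2⟩ := hmem X (hX ▸ (rank_vecMulVec_le _ _).trans hr)
    nlinarith [h1.trans h2]
  -- With no entries, every real `δ` is admissible, and `sInf` of all of `ℝ` is 0 by convention.
  · have hzero : ∀ X : Matrix (Fin m) (Fin n) ℝ, X = 0 := fun X => by
      ext i j
      exact absurd ⟨i.pos, j.pos⟩ hmn
    have huniv : ripSet 𝒜 r = Set.univ := Set.eq_univ_of_forall fun δ X _ => by
      simp [hzero X]
    rw [ripConst, huniv]
    simp

/-! ### Arithmetic of the constants -/

section Constants

variable {k t : ℕ} {δ η : ℝ}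

/-- Since `(1 + √2)² = 3 + 2√2 < 6`; this makes the denominator of `θ_k` positive. -/
theorem one_add_sqrt_two_lt_sqrt (hk : 6 ≤ k) : 1 + √2 < √(k : ℝ) := by
  have hk' : (6 : ℝ) ≤ k := by exact_mod_cast hk
  have h2 : √2 ^ 2 = (2 : ℝ) := Real.sq_sqrt (by norm_num)
  have h0 := Real.sqrt_nonneg 2
  refine Real.lt_sqrt_of_sq_lt ?_
  nlinarith

theorem lt_one_and_beta₁_mul_theta_lt_one (hk : 6 ≤ k) (ht : 1 < t) (hδ0 : 0 ≤ δ)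
    (hδ : δ < √(((t : ℝ) - 1) / ((t : ℝ) + theta k ^ 2 - 1))) :
    δ < 1 ∧ beta₁ t δ * theta k < 1 := by
  have ht' : (1 : ℝ) < t := by exact_mod_cast ht
  have hsk := one_add_sqrt_two_lt_sqrt hk
  have h0 := Real.sqrt_nonneg 2
  have hθ : 0 < theta k := div_pos (by linarith) (by linarith)
  have hθ2 : 0 < theta k ^ 2 := by positivity
  have h1 : δ ^ 2 < ((t : ℝ) - 1) / ((t : ℝ) + theta k ^ 2 - 1) := (Real.lt_sqrt hδ0).1 hδ
  rw [lt_div_iff₀ (by linarith)] at h1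
  have hlt : δ < 1 := by
    by_contra! h
    have h2 : 1 ≤ δ ^ 2 := one_le_pow₀ h
    nlinarith
  have hR : 0 < ((t : ℝ) - 1) * (1 - δ ^ 2) := mul_pos (by linarith) (by nlinarith)
  refine ⟨hlt, ?_⟩
  rw [beta₁, div_mul_eq_mul_div, div_lt_one (Real.sqrt_pos.2 hR)]
  refine Real.lt_sqrt_of_sq_lt ?_
  nlinarith

theorem beta₁_nonneg (hδ0 : 0 ≤ δ) : 0 ≤ beta₁ t δ := div_nonneg hδ0 (Real.sqrt_nonneg _)

theorem gamma₁_pos (hδ0 : 0 ≤ δ) (hδ1 : δ < 1) : 0 < gamma₁ δ := by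
  have : 0 < 1 - δ := by linarith
  unfold gamma₁
  positivity

theorem gammaHat₁_pos (hk : 0 < k) (hδ0 : 0 ≤ δ) (hδ1 : δ < 1) (hη : 0 ≤ η) :
    0 < gammaHat₁ k δ η := by
  have := gamma₁_pos hδ0 hδ1
  unfold gammaHat₁
  positivity

theorem beta₁_lt_one (hk : 6 ≤ k) (hβ : beta₁ t δ * theta k < 1) :
    beta₁ t δ < 1 := by
  have hsk := one_add_sqrt_two_lt_sqrt hk
  have h2 : 1 ≤ √2 := Real.one_le_sqrt.2 (by norm_num)
  have hθ : 1 ≤ theta k := by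
    rw [theta, one_le_div (by linarith)]
    linarith
  nlinarith

/-- As `β̂₁ ≤ √2`, also `ξ₁ ≤ √2 γ̂₁`, so it suffices that `β̂₁ + √2 < √k (1 - β₁)`. This rearranges
exactly to `β₁ θ_k < 1`, which explains the form of `θ_k`. -/
theorem kappa₁_pos (hk : 6 ≤ k) (hδ0 : 0 ≤ δ) (hδ1 : δ < 1) (hη : 0 ≤ η)
    (hβ : beta₁ t δ * theta k < 1) : 0 < kappa₁ k t δ η := by
  have hsk := one_add_sqrt_two_lt_sqrt hk
  have h2 : 1 ≤ √2 := Real.one_le_sqrt.2 (by norm_num)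
  have h22 : √2 * √2 = 2 := Real.mul_self_sqrt (by norm_num)
  have hβ0 := beta₁_nonneg (t := t) hδ0
  have hβ1 := beta₁_lt_one hk hβ
  have hγ := gammaHat₁_pos (by omega : 0 < k) hδ0 hδ1 hη
  have hQ : 0 < √(k : ℝ) * (1 - beta₁ t δ) := mul_pos (by linarith) (by linarith)
  rw [theta, mul_div_assoc', div_lt_one (by linarith)] at hβ
  rw [kappa₁, sub_pos, div_lt_one (mul_pos hQ hγ)]
  have hξ : xi₁ k t δ η ≤ √2 * gammaHat₁ k δ η := by
    rw [xi₁, gammaHat₁, Real.sqrt_mul (by norm_num), mul_add, mul_assoc]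
    have : betaHat₁ t δ ≤ √2 := by
      unfold betaHat₁
      nlinarith
    gcongr
  have h3 : betaHat₁ t δ + √2 < √(k : ℝ) * (1 - beta₁ t δ) := by
    unfold betaHat₁
    nlinarith
  nlinarith

/-- The arithmetic that turns the bounds on the head and the tail of the error into the stated
error estimate. -/
theorem le_const₁_mul_add_const₂_mul (hk : 0 < k) (hδ0 : 0 ≤ δ) (hδ1 : δ < 1) (hη : 0 ≤ η)
    (hβ1 : beta₁ t δ < 1) (hκ : 0 < kappa₁ k t δ η) {f N a q lam : ℝ} (hlam : 0 < lam)
    (hN : 0 ≤ N) (hf0 : 0 ≤ f) (ha0 : 0 ≤ a) (hq0 : 0 ≤ q)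
    (hf : f ≤ beta₁ t δ * (q / √(k : ℝ)) + gamma₁ δ * a + q / √(k : ℝ))
    (hq : q + a ^ 2 / (2 * lam) ≤ 2 * N + f + η * a) :
    f ≤ const₁ k t δ η * N + const₂ k t δ η * lam := by
  have hβ0 := beta₁_nonneg (t := t) hδ0
  have hγ := gamma₁_pos hδ0 hδ1
  have hγ' := gammaHat₁_pos hk hδ0 hδ1 hη
  have hsk : 0 < √(k : ℝ) := Real.sqrt_pos.2 (by exact_mod_cast hk)
  have h2 : 1 ≤ √2 := Real.one_le_sqrt.2 (by norm_num)
  have hβ' : 1 ≤ betaHat₁ t δ := by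
    unfold betaHat₁
    nlinarith
  have hξ0 : 0 ≤ xi₁ k t δ η := by
    unfold xi₁
    positivity
  have hq' : q ≤ 2 * N + f + η * a := by
    have : 0 ≤ a ^ 2 / (2 * lam) := by positivity
    linarith
  -- A root-free bound from the quadratic inequality `a² ≤ 2λ(2N + f + ηa)`. Using `γ̂₁ ≥ η` in
  -- place of `η` also avoids dividing by `η`, which may be zero.
  have ha : a ≤ 2 * lam * gammaHat₁ k δ η + (2 * N + f) / gammaHat₁ k δ η := by
    have h1 : a ^ 2 ≤ (2 * N + f + η * a) * (2 * lam) := by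
      rw [← div_le_iff₀ (by positivity)]
      linarith
    have hηγ : η ≤ gammaHat₁ k δ η := by
      unfold gammaHat₁
      nlinarith [mul_pos hsk hγ]
    obtain ⟨c, hc⟩ : ∃ c, c = (2 * N + f) / gammaHat₁ k δ η := ⟨_, rfl⟩
    have hD : 2 * N + f = c * gammaHat₁ k δ η := by
      rw [hc, div_mul_cancel₀ _ hγ'.ne']
    have hc0 : 0 ≤ c := hc ▸ by positivity
    rw [← hc]
    rw [hD] at h1
    by_contra! h
    have h3 : (2 * lam * gammaHat₁ k δ η + c) * a ≤ a * a :=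
      mul_le_mul_of_nonneg_right h.le ha0
    have h4 : lam * a * η ≤ lam * a * gammaHat₁ k δ η := by gcongr
    have h5 : 2 * lam * gammaHat₁ k δ η < a := by linarith
    rcases hc0.eq_or_lt with h0 | hpos
    · subst h0
      have : 0 < a := lt_of_le_of_lt (by positivity) h5
      nlinarith
    · nlinarith [mul_lt_mul_of_pos_left h5 hpos]
  have hfk : f * √(k : ℝ) ≤ (1 + beta₁ t δ) * q + √(k : ℝ) * gamma₁ δ * a := by
    calc f * √(k : ℝ) ≤ (beta₁ t δ * (q / √(k : ℝ)) + gamma₁ δ * a + q / √(k : ℝ)) * √(k : ℝ) := by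
          gcongr
      _ = _ := by
          field_simp
          ring
  have hQ : 0 < √(k : ℝ) * (1 - beta₁ t δ) := mul_pos hsk (by linarith)
  -- The factor `1 - β₁` produces the stated denominator; then `1 - β₁² ≤ β̂₁` and `1 - β₁ ≤ √2` are
  -- used, so the result is not sharp.
  have hmain : f * (√(k : ℝ) * (1 - beta₁ t δ)) ≤
      betaHat₁ t δ * (2 * N + f) + xi₁ k t δ η * a := by
    have e1 : betaHat₁ t δ * (2 * N + f) + xi₁ k t δ η * a =
        betaHat₁ t δ * (2 * N + f + η * a) + √2 * (√(k : ℝ) * gamma₁ δ * a) := by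
      rw [xi₁, Real.sqrt_mul (by norm_num)]
      ring
    have hga : 0 ≤ √(k : ℝ) * gamma₁ δ * a := by positivity
    rw [e1]
    calc f * (√(k : ℝ) * (1 - beta₁ t δ)) = (1 - beta₁ t δ) * (f * √(k : ℝ)) := by ring
      _ ≤ (1 - beta₁ t δ) * ((1 + beta₁ t δ) * q + √(k : ℝ) * gamma₁ δ * a) :=
          mul_le_mul_of_nonneg_left hfk (by linarith)
      _ = (1 - beta₁ t δ ^ 2) * q + (1 - beta₁ t δ) * (√(k : ℝ) * gamma₁ δ * a) := by ring
      _ ≤ betaHat₁ t δ * (2 * N + f + η * a) + √2 * (√(k : ℝ) * gamma₁ δ * a) :=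
          add_le_add (mul_le_mul (by nlinarith) hq' hq0 (by linarith))
            (mul_le_mul_of_nonneg_right (by linarith) hga)
  have hfin : f * (√(k : ℝ) * (1 - beta₁ t δ)) ≤ betaHat₁ t δ * (2 * N + f) +
      xi₁ k t δ η * (2 * lam * gammaHat₁ k δ η + (2 * N + f) / gammaHat₁ k δ η) := by
    refine hmain.trans ?_
    gcongr
  -- Moving the `f` terms to the left leaves exactly the factor `κ₁`.
  have hκf : f * kappa₁ k t δ η * (√(k : ℝ) * (1 - beta₁ t δ)) ≤
      2 * ((betaHat₁ t δ * gammaHat₁ k δ η + xi₁ k t δ η) / gammaHat₁ k δ η) * N +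
        2 * xi₁ k t δ η * gammaHat₁ k δ η * lam := by
    have e1 : f * kappa₁ k t δ η * (√(k : ℝ) * (1 - beta₁ t δ)) =
        f * (√(k : ℝ) * (1 - beta₁ t δ)) -
          f * ((betaHat₁ t δ * gammaHat₁ k δ η + xi₁ k t δ η) / gammaHat₁ k δ η) := by
      have : 1 - beta₁ t δ ≠ 0 := by linarith
      rw [kappa₁]
      field_simp
    have e2 : (betaHat₁ t δ * gammaHat₁ k δ η + xi₁ k t δ η) / gammaHat₁ k δ η =
        betaHat₁ t δ + xi₁ k t δ η / gammaHat₁ k δ η := by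
      field_simp
    rw [e1, e2]
    have e3 : xi₁ k t δ η * ((2 * N + f) / gammaHat₁ k δ η) =
        xi₁ k t δ η / gammaHat₁ k δ η * (2 * N + f) := by ring
    linarith
  have e : const₁ k t δ η * N + const₂ k t δ η * lam =
      (2 * ((betaHat₁ t δ * gammaHat₁ k δ η + xi₁ k t δ η) / gammaHat₁ k δ η) * N +
        2 * xi₁ k t δ η * gammaHat₁ k δ η * lam) /
        (kappa₁ k t δ η * (√(k : ℝ) * (1 - beta₁ t δ))) := by
    have : 1 - beta₁ t δ ≠ 0 := by linarith
    rw [const₁, const₂]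
    field_simp
  rw [e, le_div_iff₀ (mul_pos hκ hQ)]
  linarith

end Constants

/-! ### Head, tail and minimality -/

/-- Dividing `SparseRIP.sq_le` by `1 - δ²` gives `x² ≤ P² + Q x` with `P = β₁ q/√k` and `Q = γ₁‖B
σ‖`, hence `x ≤ P + Q`. -/
theorem SparseRIP.sqrt_sum_sq_le {ι E : Type*} [Fintype ι] [DecidableEq ι]
    [NormedAddCommGroup E] [InnerProductSpace ℝ E] {B : (ι → ℝ) →ₗ[ℝ] E} {δ : ℝ} {k t : ℕ}
    (hk : 0 < k) (ht : 1 < t) (hB : SparseRIP B (t * k) δ) (hδ0 : 0 ≤ δ) (hδ1 : δ < 1)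
    {σ : ι → ℝ} (hσ : ∀ i, 0 ≤ σ i) {S : Finset ι} (hS : S.card ≤ k) :
    √(∑ i ∈ S, σ i ^ 2) ≤ beta₁ t δ * ((∑ i ∈ Sᶜ, σ i) / √(k : ℝ)) + gamma₁ δ * ‖B σ‖ := by
  obtain ⟨x, hx0, hx, hle⟩ := hB.sq_le hk ht hδ0 hσ hS
  refine (Real.sqrt_le_left hx0 |>.2 hx).trans ?_
  have hq0 : 0 ≤ ∑ i ∈ Sᶜ, σ i := Finset.sum_nonneg fun i _ => hσ i
  generalize ∑ i ∈ Sᶜ, σ i = q at *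
  have hk' : (0 : ℝ) < k := by exact_mod_cast hk
  have ht' : (0 : ℝ) < t - 1 := by
    have : (1 : ℝ) < t := by exact_mod_cast ht
    linarith
  have h1δ : 0 < 1 - δ := by linarith
  have h1δ2 : 0 < 1 - δ ^ 2 := by nlinarith
  have hP : (1 - δ ^ 2) * (beta₁ t δ * (q / √(k : ℝ))) ^ 2 =
      δ ^ 2 * (q ^ 2 / (k * (t - 1))) := by
    rw [beta₁, mul_pow, div_pow, div_pow, Real.sq_sqrt (by positivity), Real.sq_sqrt hk'.le]
    field_simp
  have hQ : (1 - δ ^ 2) * gamma₁ δ = 2 * √(1 + δ) := by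
    have hs : √(1 + δ) * √(1 + δ) = 1 + δ := Real.mul_self_sqrt (by linarith)
    have hs0 : 0 < √(1 + δ) := Real.sqrt_pos.2 (by linarith)
    rw [gamma₁, mul_div_assoc', div_eq_iff (by positivity)]
    linear_combination (-2 * (1 - δ)) * hs
  have hP0 : 0 ≤ beta₁ t δ * (q / √(k : ℝ)) :=
    mul_nonneg (beta₁_nonneg hδ0) (by positivity)
  have hQ0 : 0 ≤ gamma₁ δ * ‖B σ‖ := mul_nonneg (gamma₁_pos hδ0 hδ1).le (norm_nonneg _)
  have hle' : (1 - δ ^ 2) * x ^ 2 ≤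
      (1 - δ ^ 2) * ((beta₁ t δ * (q / √(k : ℝ))) ^ 2 + gamma₁ δ * ‖B σ‖ * x) := by
    rw [mul_add, hP]
    linear_combination hle - x * ‖B σ‖ * hQ
  have hx2 := le_of_mul_le_mul_left hle' h1δ2
  generalize beta₁ t δ * (q / √(k : ℝ)) = P at *
  generalize gamma₁ δ * ‖B σ‖ = Q at *
  by_contra! h
  nlinarith

/-- If there is a tail, the head has exactly `k` entries, so each tail entry is at most the head's
ℓ² norm `p` over `√k`. The tail's squares then sum to at most `p q/√k`, and `p² + p q/√k ≤ (p +
q/√k)²`. -/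
theorem sqrt_sum_sq_le_head_add_tail {r k : ℕ} (hk : 0 < k) {σ : Fin r → ℝ} (hσ : ∀ i, 0 ≤ σ i)
    (hanti : Antitone σ) :
    ∃ S : Finset (Fin r), S.card ≤ k ∧
      √(∑ i, σ i ^ 2) ≤ √(∑ i ∈ S, σ i ^ 2) + (∑ i ∈ Sᶜ, σ i) / √(k : ℝ) := by
  set S : Finset (Fin r) := Finset.univ.filter fun i => (i : ℕ) < k with hS
  have hScard : S.card = min r k := by
    rw [hS, Fin.card_filter_val_lt]
  refine ⟨S, hScard ▸ min_le_right _ _, ?_⟩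
  have hk' : (0 : ℝ) < k := by exact_mod_cast hk
  have hp0 : 0 ≤ ∑ i ∈ S, σ i ^ 2 := Finset.sum_nonneg fun i _ => sq_nonneg _
  have htail : ∀ i ∈ Sᶜ, σ i ≤ √(∑ i ∈ S, σ i ^ 2) / √(k : ℝ) := fun i hi => by
    have hi' : k ≤ i := by simpa [hS] using hi
    have hcard : S.card = k := by
      have := i.2
      omega
    rw [← Real.sqrt_div hp0]
    refine Real.le_sqrt_of_sq_le ?_
    rw [le_div_iff₀ hk', mul_comm, ← hcard, ← nsmul_eq_mul]
    refine Finset.card_nsmul_le_sum _ _ _ fun j hj => ?_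
    have hj' : (j : ℕ) < k := (Finset.mem_filter.1 hj).2
    have hji : j ≤ i := Fin.le_def.2 (by omega)
    exact pow_le_pow_left₀ (hσ i) (hanti hji) 2
  have hq0 : 0 ≤ ∑ i ∈ Sᶜ, σ i := Finset.sum_nonneg fun i _ => hσ i
  have hsq : ∑ i ∈ Sᶜ, σ i ^ 2 ≤ √(∑ i ∈ S, σ i ^ 2) / √(k : ℝ) * ∑ i ∈ Sᶜ, σ i := by
    rw [Finset.mul_sum]
    refine Finset.sum_le_sum fun i hi => ?_
    rw [sq]
    exact mul_le_mul_of_nonneg_right (htail i hi) (hσ i)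
  refine Real.sqrt_le_iff.2 ⟨by positivity, ?_⟩
  rw [← Finset.sum_add_sum_compl S]
  have h1 := Real.sq_sqrt hp0
  have h2 : √(∑ i ∈ S, σ i ^ 2) / √(k : ℝ) * ∑ i ∈ Sᶜ, σ i =
      √(∑ i ∈ S, σ i ^ 2) * ((∑ i ∈ Sᶜ, σ i) / √(k : ℝ)) := by ring
  have h3 : 0 ≤ √(∑ i ∈ S, σ i ^ 2) * ((∑ i ∈ Sᶜ, σ i) / √(k : ℝ)) := by positivity
  nlinarith [sq_nonneg ((∑ i ∈ Sᶜ, σ i) / √(k : ℝ))]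

theorem exists_tail_norm_le {m n l k t : ℕ} (hk : 0 < k) (ht : 1 < t) {δ : ℝ} (hδ0 : 0 ≤ δ)
    (hδ1 : δ < 1) {𝒜 : Matrix (Fin m) (Fin n) ℝ →ₗ[ℝ] EuclideanSpace ℝ (Fin l)}
    (hδ : δ ∈ ripSet 𝒜 (t * k)) (H : Matrix (Fin m) (Fin n) ℝ) :
    ∃ q : ℝ, 0 ≤ q ∧ q ≤ nuclearNorm H ∧
      ‖H‖ ≤ beta₁ t δ * (q / √(k : ℝ)) + gamma₁ δ * ‖𝒜 H‖ + q / √(k : ℝ) := by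
  obtain ⟨r, U, V, σ, hU, hV, hσ, hanti, hH, hN⟩ := exists_svd H
  obtain ⟨S, hS, hle⟩ := sqrt_sum_sq_le_head_add_tail hk hσ hanti
  refine ⟨∑ i ∈ Sᶜ, σ i, Finset.sum_nonneg fun i _ => hσ i, hN ▸
    Finset.sum_le_sum_of_subset_of_nonneg (Finset.subset_univ _) fun i _ _ => hσ i, ?_⟩
  have h1 := (sparseRIP_comp_synthesis hδ hU hV).sqrt_sum_sq_le hk ht hδ0 hδ1 hσ hS
  have h2 : (𝒜 ∘ₗ synthesis U V) σ = 𝒜 H := by rw [hH]; rfl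
  have h3 : ‖H‖ = √(∑ i, σ i ^ 2) := by
    rw [← norm_sq_mul_diagonal_mul hU hV, ← hH, Real.sqrt_sq (norm_nonneg _)]
  rw [h2] at h1
  rw [h3]
  linarith

/-- In `J(X) ≤ J(X₀)` the `‖s‖²` terms cancel, and Cauchy–Schwarz bounds the remaining cross term by
`(ε/λ)‖𝒜 (X - X₀)‖`. -/
theorem nuclearNorm_sub_add_le_of_isMinOn {m n l : ℕ}
    {𝒜 : Matrix (Fin m) (Fin n) ℝ →ₗ[ℝ] EuclideanSpace ℝ (Fin l)}
    {X X₀ : Matrix (Fin m) (Fin n) ℝ} {s : EuclideanSpace ℝ (Fin l)} {ε lam : ℝ}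
    (hlam : 0 < lam) (hs : ‖s‖ ≤ ε) (hX : IsMinOn (objective 𝒜 (𝒜 X₀ + s) lam) Set.univ X) :
    nuclearNorm (X - X₀) + ‖𝒜 (X - X₀)‖ ^ 2 / (2 * lam) ≤
      2 * nuclearNorm X₀ + ‖X - X₀‖ + ε / lam * ‖𝒜 (X - X₀)‖ := by
  have h1 : objective 𝒜 (𝒜 X₀ + s) lam X ≤ objective 𝒜 (𝒜 X₀ + s) lam X₀ :=
    hX (Set.mem_univ X₀)
  have e1 : 𝒜 X - (𝒜 X₀ + s) = 𝒜 (X - X₀) - s := by rw [map_sub]; abel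
  have e2 : 𝒜 X₀ - (𝒜 X₀ + s) = -s := by abel
  rw [objective, objective, e1, e2, norm_neg, norm_sub_sq_real] at h1
  have hcs : inner ℝ (𝒜 (X - X₀)) s ≤ ‖𝒜 (X - X₀)‖ * ε :=
    (real_inner_le_norm _ _).trans (mul_le_mul_of_nonneg_left hs (norm_nonneg _))
  have h2 := nuclearNorm_sub_le X X₀
  have h3 : ‖X‖ - ‖X₀‖ ≤ ‖X - X₀‖ := norm_sub_norm_le _ _
  have h4 := mul_le_mul_of_nonneg_left hcs (by positivity : 0 ≤ 1 / lam)
  have e3 : ‖𝒜 (X - X₀)‖ ^ 2 / (2 * lam) = 1 / (2 * lam) * ‖𝒜 (X - X₀)‖ ^ 2 := by ring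
  have e4 : 1 / (2 * lam) * (‖𝒜 (X - X₀)‖ ^ 2 - 2 * inner ℝ (𝒜 (X - X₀)) s + ‖s‖ ^ 2) =
      1 / (2 * lam) * ‖𝒜 (X - X₀)‖ ^ 2 - 1 / lam * inner ℝ (𝒜 (X - X₀)) s +
        1 / (2 * lam) * ‖s‖ ^ 2 := by
    field_simp
  have e5 : ε / lam * ‖𝒜 (X - X₀)‖ = 1 / lam * (‖𝒜 (X - X₀)‖ * ε) := by ring
  rw [e4] at h1
  rw [e3, e5]
  linarith

end LowRankRecovery

theorem mainTheorem6 {m n l : ℕ}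
    (𝒜 : Matrix (Fin m) (Fin n) ℝ →ₗ[ℝ] EuclideanSpace ℝ (Fin l))
    (X₀ : Matrix (Fin m) (Fin n) ℝ) (b s : EuclideanSpace ℝ (Fin l))
    (ε lam : ℝ) (hlam : 0 < lam)
    (hb : b = 𝒜 X₀ + s) (hs : ‖s‖ ≤ ε)
    (k t : ℕ) (hk : 6 ≤ k) (ht : 1 < t)
    (hδ : LowRankRecovery.ripConst 𝒜 (t * k) <
      √(((t : ℝ) - 1) / ((t : ℝ) + LowRankRecovery.theta k ^ 2 - 1)))
    (X : Matrix (Fin m) (Fin n) ℝ)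
    (hX : IsMinOn (LowRankRecovery.objective 𝒜 b lam) Set.univ X) :
    (LowRankRecovery.ripConst 𝒜 (t * k) < 1 ∧
      LowRankRecovery.beta₁ t (LowRankRecovery.ripConst 𝒜 (t * k)) < 1 ∧
      0 < LowRankRecovery.gammaHat₁ k (LowRankRecovery.ripConst 𝒜 (t * k)) (ε / lam) ∧
      0 < LowRankRecovery.kappa₁ k t (LowRankRecovery.ripConst 𝒜 (t * k)) (ε / lam)) ∧
    ‖X - X₀‖ ≤
      LowRankRecovery.const₁ k t (LowRankRecovery.ripConst 𝒜 (t * k)) (ε / lam) *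
          LowRankRecovery.nuclearNorm X₀ +
        LowRankRecovery.const₂ k t (LowRankRecovery.ripConst 𝒜 (t * k)) (ε / lam) * lam := by

  obtain ⟨hmem, hδ0⟩ := LowRankRecovery.ripConst_mem_and_nonneg 𝒜
    (Nat.mul_pos (by omega) (by omega) : 0 < t * k)
  obtain ⟨hδ1, hβθ⟩ := LowRankRecovery.lt_one_and_beta₁_mul_theta_lt_one hk ht hδ0 hδ
  have hk0 : 0 < k := by omega
  have hη : 0 ≤ ε / lam := div_nonneg ((norm_nonneg s).trans hs) hlam.le
  have hβ1 := LowRankRecovery.beta₁_lt_one hk hβθ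
  have hκ := LowRankRecovery.kappa₁_pos hk hδ0 hδ1 hη hβθ
  refine ⟨⟨hδ1, hβ1, LowRankRecovery.gammaHat₁_pos hk0 hδ0 hδ1 hη, hκ⟩, ?_⟩
  subst hb
  obtain ⟨q, hq0, hq, hf⟩ := LowRankRecovery.exists_tail_norm_le hk0 ht hδ0 hδ1 hmem (X - X₀)
  have hmin := LowRankRecovery.nuclearNorm_sub_add_le_of_isMinOn hlam hs hX
  exact LowRankRecovery.le_const₁_mul_add_const₂_mul hk0 hδ0 hδ1 hη hβ1 hκ hlam
    (LowRankRecovery.nuclearNorm_nonneg X₀) (norm_nonneg _) (norm_nonneg _) hq0 hf (by linarith)
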